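/- Consider a Bernoulli bandit with $K\ge 2$ arms whose mean rewards $\mu_1,\dots,\mu_K$ are drawn independently from priors $\mathcal P_1,\dots,\mathcal P_K$; given the mean rewards, all samples are independent, and each sample of arm $i$ is Bernoulli with mean $\mu_i$. Let $\mu_i^0=\mathbb E[\mu_i]$, and order the arms so that $\mu_1^0\ge\dots\ge\mu_K^0$. Let $A^*=\min(\arg\max_j\mu_j)$ be the best arm, $x_+=\max(x,0)$, and let $\Delta_{j-1}$ be the set of probability distributions $q$ over arms $1,\dots,j-1$, with $\mu_q=\sum_i q_i\mu_i$. Let $\mathrm{ZEROS}_{j,N_0}$ be the event that the first $N_0$ samples of each arm $i<j$ are all $0$. Put $$\varepsilon_{TS}=\min_{i\ne j}\mathbb E[(\mu_i-\mu_j)_+],\qquad \delta_{TS}=\min_i\Pr[A^*=i],\qquad N_{TS}=C_{TS}\,\varepsilon_{TS}^{-2}\log\delta_{TS}^{-1},$$ $$G_{pad}=\min_{j\ge 2,\;q\in\Delta_{j-1}}\mathbb E[(\mu_j-\mu_q)_+],\qquad N_{pad}=C_{pad}\,G_{pad}^{-2}\log G_{pad}^{-1},$$ $$N_{boot}=\min\{N_0\in\mathbb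 N:\ \mathbb E[\mu_j-\mu_i\mid \mathrm{ZEROS}_{j,N_0}]>0\ \text{ for all arms } i<j\},\qquad p_{boot}=\min_j\Pr[\mathrm{ZEROS}_{j,N_{boot}}],$$ and let $$T_{UB}(N)=C_{UB}\,K\,\max(N,N_{boot},N_{pad})\;G_{pad}^{-1}\,\log\!\big(G_{pad}^{-1}p_{boot}^{-1}\big)$$ be the upper bound on the number of rounds in which the exponential exploration algorithm collects $N$ samples of each arm. Here $C_{TS},C_{pad},C_{UB}>0$ are arbitrary absolute constants. Then there is a constant $c>0$, depending only on $C_{TS},C_{pad},C_{UB}$, with the following property. Suppose $\mathcal P_i=\mathrm{Beta}(a_i,b_i)$ with $a_i,b_i>0$ for every arm $i$, and call $a_i+b_i$ the strength of $\mathcal P_i$. Suppose some arm $\ell$ has strength $M$, and every other arm $i\neq\ell$ has $a_i,b_i\ge 1$ and strength at most $m$, where $M\ge m\ge 2$ are real numbers. Then $\varepsilon_{TS},\delta_{TS},G_{pad},p_{boot}$ are positive, $N_{boot}$ is well-defined (finite), and $$T_{UB}(N_{TS})\ \le\ M^2\,K^{c}\,\max\!\Big(m,\ (1-\mu_\ell^0)^{-1},\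 (\mu_\ell^0)^{-(\ell-1)}\Big)^{c\,m}.$$ In particular, if $\mu_\ell^0\in[1/4,3/4]$, then $$T_{UB}(N_{TS})\ \le\ M^2\,K^{c}\,m^{c\,\ell\,m}.$$ -/

import Mathlib

open MeasureTheory ProbabilityTheory

noncomputable section

namespace IncentivizedExploration

variable {K : ℕ}

/-- Prior mean reward `μ⁰ = E[μ]` of an arm with prior `P`. -/
def priorMean (P : Measure ℝ) : ℝ := ∫ x, x ∂P

/-- The joint prior `P₁ × ⋯ × P_K` of the vector `(μ₁, …, μ_K)` of mean rewards. -/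
def jointPrior (P : Fin K → Measure ℝ) : Measure (Fin K → ℝ) := Measure.pi P

/-- The mean reward `μ_q = ∑ i, q i * μ i` of a distribution `q` over arms. -/
def mixReward (q μ : Fin K → ℝ) : ℝ := ∑ i, q i * μ i

/-- The event `A* = i`, where `A* = min (argmax_j μ_j)` is the best arm, ties being broken in
favour of the smallest index. -/
def bestArmEvent (i : Fin K) : Set (Fin K → ℝ) :=
  {μ | (∀ j, μ j ≤ μ i) ∧ ∀ j, j < i → μ j < μ i}

/-! Thompson Sampling parameters. -/

/-- `ε_TS`: the minimum of `E[(μ_i - μ_j)₊]` over distinct arms `i`, `j`. -/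
def epsTS (P : Fin K → Measure ℝ) : ℝ :=
  sInf {x | ∃ i j : Fin K, i ≠ j ∧ x = ∫ μ, max (μ i - μ j) 0 ∂(jointPrior P)}

/-- `δ_TS`: the minimum of `Pr[A* = i]` over all arms `i`. -/
def deltaTS (P : Fin K → Measure ℝ) : ℝ :=
  ⨅ i : Fin K, (jointPrior P).real (bestArmEvent i)

/-- `N_TS = C_TS * ε_TS⁻² * log (δ_TS⁻¹)`. -/
def nTS (C : ℝ) (P : Fin K → Measure ℝ) : ℝ :=
  C * ((epsTS P)⁻¹) ^ 2 * Real.log (deltaTS P)⁻¹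

/-! Parameters of the padded phase. -/

/-- `Δ_{<j}`: the distributions over the arms with index smaller than `j` (there are none when `j`
is the first arm). -/
def simplexBelow (j : Fin K) : Set (Fin K → ℝ) :=
  {q | q ∈ stdSimplex ℝ (Fin K) ∧ ∀ i, j ≤ i → q i = 0}

/-- `G_pad`: the minimum of `E[(μ_j - μ_q)₊]` over all arms `j` and all distributions `q` over the
arms preceding `j`. -/
def gPad (P : Fin K → Measure ℝ) : ℝ :=
  sInf {x | ∃ j : Fin K, ∃ q ∈ simplexBelow j,
    x = ∫ μ, max (μ j - mixReward q μ) 0 ∂(jointPrior P)}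

/-- `N_pad = C_pad * G_pad⁻² * log (G_pad⁻¹)`. -/
def nPad (C : ℝ) (P : Fin K → Measure ℝ) : ℝ :=
  C * ((gPad P)⁻¹) ^ 2 * Real.log (gPad P)⁻¹

/-! The reward model and the parameters of the bootstrapping phase. -/

/-- The joint law of the mean rewards and of independent uniform seeds, one for every arm and every
sample index; the seeds are independent of the mean rewards. -/
def rewardModel (P : Fin K → Measure ℝ) :
    Measure ((Fin K → ℝ) × (Fin K × ℕ → unitInterval)) :=
  (jointPrior P).prod (Measure.infinitePi fun _ => (volume : Measure unitInterval))

/-- The reward of the `n`-th sample of arm `i`: it is `1` if the seed lies below `μ_i` and `0`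
otherwise. Given the mean rewards, the rewards are therefore independent, and those of arm `i` are
Bernoulli with mean `μ_i`. -/
def reward (i : Fin K) (n : ℕ) (ω : (Fin K → ℝ) × (Fin K × ℕ → unitInterval)) : ℕ :=
  if (ω.2 (i, n) : ℝ) < ω.1 i then 1 else 0

/-- `ZEROS_{j,N₀}`: the first `N₀` samples of each arm `i < j` return reward `0`. -/
def zerosEvent (j : Fin K) (N₀ : ℕ) : Set ((Fin K → ℝ) × (Fin K × ℕ → unitInterval)) :=
  {ω | ∀ i, i < j → ∀ n, n < N₀ → reward i n ω = 0}

/-- `E[μ_j - μ_i | ZEROS_{j,N₀}] > 0` for all arms `i < j`. -/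
def BootCondition (P : Fin K → Measure ℝ) (N₀ : ℕ) : Prop :=
  ∀ i j : Fin K, i < j →
    0 < ∫ ω, (ω.1 j - ω.1 i) ∂(ProbabilityTheory.cond (rewardModel P) (zerosEvent j N₀))

/-- `N_boot`: the smallest `N₀` that satisfies the condition above. -/
def nBoot (P : Fin K → Measure ℝ) : ℕ := sInf {N₀ | BootCondition P N₀}

/-- `p_boot`: the minimum of `Pr[ZEROS_{j,N_boot}]` over all arms `j`. -/
def pBoot (P : Fin K → Measure ℝ) : ℝ :=
  ⨅ j : Fin K, (rewardModel P).real (zerosEvent j (nBoot P))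

/-- The upper bound `T_UB(N) = C * K * N * G_pad⁻¹ * log (G_pad⁻¹ * p_boot⁻¹)` on the time in which
exponential exploration collects `N` samples of each arm, for `N ≥ max (N_boot, N_pad)`; smaller
values of `N` are first raised to `max (N_boot, N_pad)`. The constant `C` is the one implicit in
the `O`-notation, and `Cpad` is the constant in `N_pad`. -/
def rndsUB (C Cpad : ℝ) (P : Fin K → Measure ℝ) (N : ℝ) : ℝ :=
  C * K * max N (max (nBoot P : ℝ) (nPad Cpad P)) * (gPad P)⁻¹ *
    Real.log ((gPad P)⁻¹ * (pBoot P)⁻¹)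

/-- All parameters that enter the upper bound are genuine: the quantities that are inverted are
positive, and `N_boot` is the minimum of a nonempty set. -/
structure WellDefined (P : Fin K → Measure ℝ) : Prop where
  epsTS_pos : 0 < epsTS P
  deltaTS_pos : 0 < deltaTS P
  gPad_pos : 0 < gPad P
  boot_nonempty : ∃ N₀, BootCondition P N₀
  pBoot_pos : 0 < pBoot P

end IncentivizedExploration

end

/-! Put `X = max m (max (1 - u)⁻¹ (u⁻¹ ^ ℓ))` with `u` the prior mean of the strong arm `ℓ`, and `Y
= X ^ m`. Every prior mean then lies in `[X⁻¹, 1 - X⁻¹]`, and the bound follows once every parameter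
is controlled by `K`, `Y` and `M`.

A weak arm has both parameters at least 1 and strength at most `m`, so it lies within `t` of either
end of `[0, 1]` with probability at least `t ^ m` (`rpow_le_betaMeasure_real_Iio`,
`rpow_le_betaMeasure_real_Ioi`). The strong arm may be too concentrated for this; it enters the gap,
best-arm and zero-sample estimates only through its mean, by independence, a Markov bound and
Jensen.

A gap `E[(μ_j - μ_q)₊]` with `j` weak is bounded below by letting `μ_j` be near 1. With `j = ℓ`, all
arms before `ℓ` are instead required to fall slightly below `u`, which has probability about `u ^ (ℓ
m)`; this is why `u⁻¹ ^ ℓ` is part of `X`. Both gaps are at least `(K Y³)⁻¹`. One arm above and all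
others below a threshold give `δ_TS ≥ Y ^ (-2K)`. By conjugacy, `⌈M X⌉` zeros push each posterior
mean below all prior means, so `N_boot ≤ ⌈M X⌉` and `log p_boot⁻¹` is at most linear in `M`. These
two quantities produce the factor `M²`; the rest is polynomial in `K` and `Y`. -/

namespace ProbabilityTheory

/-! ### Moments and tail bounds of the beta distribution. -/

lemma betaPDFReal_nonneg {a b : ℝ} (ha : 0 < a) (hb : 0 < b) (x : ℝ) : 0 ≤ betaPDFReal a b x := by
  by_cases hx : 0 < x ∧ x < 1
  · exact (betaPDFReal_pos hx.1 hx.2 ha hb).le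
  · simp [betaPDFReal, hx]

lemma integral_betaPDFReal {a b : ℝ} (ha : 0 < a) (hb : 0 < b) : ∫ x, betaPDFReal a b x = 1 := by
  rw [integral_eq_lintegral_of_nonneg_ae (.of_forall (betaPDFReal_nonneg ha hb))
    (measurable_betaPDFReal a b).aestronglyMeasurable]
  change (∫⁻ x, betaPDF a b x).toReal = 1
  simp [ha, hb]

lemma integrable_betaPDFReal {a b : ℝ} (ha : 0 < a) (hb : 0 < b) :
    Integrable (betaPDFReal a b) :=
  .of_integral_ne_zero (by simp [integral_betaPDFReal ha hb])

lemma integral_betaMeasure {a b : ℝ} (ha : 0 < a) (hb : 0 < b) (f : ℝ → ℝ) :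
    ∫ x, f x ∂(betaMeasure a b) = ∫ x, betaPDFReal a b x * f x := by
  have hm : Measurable (betaPDF a b) := (measurable_betaPDFReal a b).ennreal_ofReal
  rw [betaMeasure, integral_withDensity_eq_integral_toReal_smul hm
    (.of_forall fun x ↦ ENNReal.ofReal_lt_top)]
  refine integral_congr_ae (.of_forall fun x ↦ ?_)
  simp [betaPDF, ENNReal.toReal_ofReal (betaPDFReal_nonneg ha hb x)]

lemma ae_betaMeasure_mem_Ioo {a b : ℝ} : ∀ᵐ x ∂(betaMeasure a b), x ∈ Set.Ioo (0 : ℝ) 1 := by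
  have hm : Measurable (betaPDF a b) := (measurable_betaPDFReal a b).ennreal_ofReal
  rw [betaMeasure, ae_withDensity_iff hm]
  refine .of_forall fun x hx ↦ ?_
  by_contra h
  rw [Set.mem_Ioo] at h
  simp [betaPDF, betaPDFReal, h] at hx

/-- The mixed moments of the beta distribution. -/
lemma integral_pow_mul_one_sub_pow_betaMeasure {a b : ℝ} (ha : 0 < a) (hb : 0 < b) (k n : ℕ) :
    ∫ x, x ^ k * (1 - x) ^ n ∂(betaMeasure a b) = beta (a + k) (b + n) / beta a b := by
  have hak : 0 < a + k := by positivity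
  have hbn : 0 < b + n := by positivity
  rw [integral_betaMeasure ha hb]
  have : ∀ x, betaPDFReal a b x * (x ^ k * (1 - x) ^ n) =
      beta (a + k) (b + n) / beta a b * betaPDFReal (a + k) (b + n) x := by
    intro x
    by_cases hx : 0 < x ∧ x < 1
    · have h1 : x ^ (a + k - 1) = x ^ (a - 1) * x ^ k := by
        rw [← Real.rpow_add_natCast hx.1.ne']; ring_nf
      have h2 : (1 - x) ^ (b + n - 1) = (1 - x) ^ (b - 1) * (1 - x) ^ n := by
        rw [← Real.rpow_add_natCast (sub_pos.2 hx.2).ne']; ring_nf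
      have := (beta_pos ha hb).ne'
      have := (beta_pos hak hbn).ne'
      simp only [betaPDFReal, hx, and_self, if_true, h1, h2]
      field_simp
    · simp [betaPDFReal, hx]
  simp_rw [this]
  rw [integral_const_mul, integral_betaPDFReal hak hbn, mul_one]

/-- Conjugacy: weighting by `(1 - x) ^ n`, the likelihood of `n` zeros, turns Beta(a, b) into
Beta(a, b + n), whose mean is the factor on the right. -/
lemma integral_mul_one_sub_pow_betaMeasure {a b : ℝ} (ha : 0 < a) (hb : 0 < b) (n : ℕ) :
    ∫ x, x * (1 - x) ^ n ∂(betaMeasure a b) =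
      a / (a + b + n) * ∫ x, (1 - x) ^ n ∂(betaMeasure a b) := by
  have h1 := integral_pow_mul_one_sub_pow_betaMeasure ha hb 1 n
  have h0 := integral_pow_mul_one_sub_pow_betaMeasure ha hb 0 n
  simp only [pow_one, pow_zero, one_mul, Nat.cast_one, Nat.cast_zero, add_zero] at h1 h0
  have hs : 0 < a + b + n := by positivity
  have hr : beta (a + 1) (b + n) = a / (a + b + n) * beta a (b + n) := by
    have h2 : a + 1 + (b + n) = (a + b + n) + 1 := by ring
    have h3 : a + (b + n) = a + b + n := by ring
    have := (Real.Gamma_pos_of_pos hs).ne'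
    rw [beta, beta, h2, h3, Real.Gamma_add_one ha.ne', Real.Gamma_add_one hs.ne']
    field_simp
  rw [h1, h0, hr]
  ring

lemma integral_id_betaMeasure {a b : ℝ} (ha : 0 < a) (hb : 0 < b) :
    ∫ x, x ∂(betaMeasure a b) = a / (a + b) := by
  have := isProbabilityMeasureBeta ha hb
  simpa using integral_mul_one_sub_pow_betaMeasure ha hb 0

lemma betaMeasure_real_apply {a b : ℝ} (ha : 0 < a) (hb : 0 < b) {s : Set ℝ}
    (hs : MeasurableSet s) :
    (betaMeasure a b).real s = ∫ x, s.indicator (betaPDFReal a b) x := by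
  rw [← integral_indicator_one hs, integral_betaMeasure ha hb]
  congr 1 with x
  by_cases hx : x ∈ s <;> simp [hx]

/-- Substitute `x = t u`. Since `b ≥ 1`, `(1 - t u) ^ (b - 1) ≥ (1 - u) ^ (b - 1)`, so the density
at `t u` is at least `t ^ (a - 1)` times the density at `u`. The Jacobian supplies the last factor
`t`, and the value of `beta a b` never matters. -/
lemma rpow_le_betaMeasure_real_Iio {a b t : ℝ} (ha : 0 < a) (hb : 1 ≤ b) (ht : 0 < t)
    (ht1 : t ≤ 1) : t ^ a ≤ (betaMeasure a b).real (Set.Iio t) := by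
  have hb0 : 0 < b := by linarith
  set g : ℝ → ℝ := (Set.Iio t).indicator (betaPDFReal a b) with hg
  have hgi : Integrable g := (integrable_betaPDFReal ha hb0).indicator measurableSet_Iio
  have hsub : ∫ u, g (t * u) = t⁻¹ * ∫ x, g x := by
    rw [Measure.integral_comp_mul_left, abs_of_pos (inv_pos.2 ht), smul_eq_mul]
  have hle : t ^ (a - 1) * ∫ u, betaPDFReal a b u ≤ ∫ u, g (t * u) := by
    rw [← integral_const_mul]
    refine integral_mono ((integrable_betaPDFReal ha hb0).const_mul _)
      (hgi.comp_mul_left' ht.ne') fun u ↦ ?_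
    by_cases hu : 0 < u ∧ u < 1
    · have h1 : t * u < t := by nlinarith [hu.2]
      have h2 : 0 < t * u ∧ t * u < 1 := ⟨mul_pos ht hu.1, by linarith⟩
      have h3 : (1 - u) ^ (b - 1) ≤ (1 - t * u) ^ (b - 1) :=
        Real.rpow_le_rpow (by linarith [hu.2]) (by nlinarith [hu.1]) (by linarith)
      have h4 : 0 ≤ 1 / beta a b * (t * u) ^ (a - 1) :=
        mul_nonneg (one_div_pos.2 (beta_pos ha hb0)).le (Real.rpow_nonneg h2.1.le _)
      simp only [hg, Set.indicator, Set.mem_Iio, h1, if_true, betaPDFReal, hu, h2, and_self]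
      calc _ = 1 / beta a b * (t * u) ^ (a - 1) * (1 - u) ^ (b - 1) := by
            rw [Real.mul_rpow ht.le hu.1.le]; ring
        _ ≤ _ := mul_le_mul_of_nonneg_left h3 h4
    · have : betaPDFReal a b u = 0 := by simp [betaPDFReal, hu]
      simp only [this, mul_zero]
      exact Set.indicator_nonneg (fun x _ ↦ betaPDFReal_nonneg ha hb0 x) _
  rw [integral_betaPDFReal ha hb0, mul_one, hsub] at hle
  rw [betaMeasure_real_apply ha hb0 measurableSet_Iio]
  calc t ^ a = t * t ^ (a - 1) := by rw [Real.rpow_sub_one ht.ne']; field_simp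
    _ ≤ t * (t⁻¹ * ∫ x, g x) := by gcongr
    _ = _ := by rw [← mul_assoc, mul_inv_cancel₀ ht.ne', one_mul]

lemma betaPDFReal_one_sub (a b x : ℝ) : betaPDFReal a b (1 - x) = betaPDFReal b a x := by
  have : (0 < 1 - x ∧ 1 - x < 1) ↔ (0 < x ∧ x < 1) := by
    constructor <;> rintro ⟨h1, h2⟩ <;> constructor <;> linarith
  have hB : beta a b = beta b a := by rw [beta, beta, add_comm, mul_comm]
  simp only [betaPDFReal, this, sub_sub_cancel, hB, mul_right_comm]

lemma rpow_le_betaMeasure_real_Ioi {a b t : ℝ} (ha : 1 ≤ a) (hb : 0 < b) (ht : 0 < t)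
    (ht1 : t ≤ 1) : t ^ b ≤ (betaMeasure a b).real (Set.Ioi (1 - t)) := by
  have ha0 : 0 < a := by linarith
  refine (rpow_le_betaMeasure_real_Iio hb ha ht ht1).trans_eq ?_
  rw [betaMeasure_real_apply hb ha0 measurableSet_Iio, betaMeasure_real_apply ha0 hb
    measurableSet_Ioi, ← integral_sub_left_eq_self _ volume (1 : ℝ)]
  congr 1 with x
  simp only [Set.indicator, Set.mem_Iio, Set.mem_Ioi, betaPDFReal_one_sub]
  congr 1
  simp only [eq_iff_iff]
  constructor <;> intro h <;> linarith

end ProbabilityTheory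

namespace IncentivizedExploration

/-! ### Gaps and best-arm probabilities under an independent prior. -/

section Product

variable {K : ℕ} {P : Fin K → Measure ℝ} [∀ i, IsProbabilityMeasure (P i)]

instance isProbabilityMeasure_jointPrior : IsProbabilityMeasure (jointPrior P) := by
  unfold jointPrior; infer_instance

lemma ae_jointPrior {p : Fin K → ℝ → Prop} (h : ∀ i, ∀ᵐ x ∂(P i), p i x) :
    ∀ᵐ μ ∂(jointPrior P), ∀ i, p i (μ i) :=
  ae_all_iff.2 fun i ↦ (measurePreserving_eval P i).quasiMeasurePreserving.ae (h i)

lemma integral_prod_jointPrior (f : Fin K → ℝ → ℝ) :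
    ∫ μ, ∏ i, f i (μ i) ∂(jointPrior P) = ∏ i, ∫ x, f i x ∂(P i) :=
  integral_fintype_prod_eq_prod f

lemma integral_mul_prod_jointPrior (f : Fin K → ℝ → ℝ) (j : Fin K) :
    ∫ μ, μ j * ∏ i, f i (μ i) ∂(jointPrior P) =
      (∫ x, x * f j x ∂(P j)) * ∏ i ∈ Finset.univ.erase j, ∫ x, f i x ∂(P i) := by
  have h1 : ∀ μ : Fin K → ℝ, μ j * ∏ i, f i (μ i) =
      ∏ i, (fun x ↦ if i = j then x * f i x else f i x) (μ i) := by
    intro μ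
    rw [← Finset.mul_prod_erase _ _ (Finset.mem_univ j),
      ← Finset.mul_prod_erase _ _ (Finset.mem_univ j)]
    simp only [if_true, mul_assoc]
    congr 2
    refine Finset.prod_congr rfl fun i hi ↦ ?_
    simp [Finset.ne_of_mem_erase hi]
  simp_rw [h1]
  refine (integral_prod_jointPrior fun i x ↦ if i = j then x * f i x else f i x).trans ?_
  rw [← Finset.mul_prod_erase _ _ (Finset.mem_univ j)]
  simp only [if_true]
  congr 1
  refine Finset.prod_congr rfl fun i hi ↦ ?_
  simp [Finset.ne_of_mem_erase hi]

lemma integrable_prod_jointPrior {f : Fin K → ℝ → ℝ} (hf : ∀ i, Measurable (f i))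
    (h : ∀ i, ∀ᵐ x ∂(P i), f i x ∈ Set.Icc (0 : ℝ) 1) :
    Integrable (fun μ : Fin K → ℝ ↦ ∏ i, f i (μ i)) (jointPrior P) := by
  refine Integrable.of_bound (C := 1) ?_ ?_
  · exact (Finset.measurable_prod _ fun i _ ↦
      (hf i).comp (measurable_pi_apply i)).aestronglyMeasurable
  · filter_upwards [ae_jointPrior h] with μ hμ
    rw [Real.norm_of_nonneg (Finset.prod_nonneg fun i _ ↦ (hμ i).1)]
    exact Finset.prod_le_one (fun i _ ↦ (hμ i).1) fun i _ ↦ (hμ i).2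

lemma integrable_mul_prod_jointPrior (hP : ∀ i, ∀ᵐ x ∂(P i), x ∈ Set.Ioo (0 : ℝ) 1)
    {f : Fin K → ℝ → ℝ} (hf : ∀ i, Measurable (f i))
    (h : ∀ i, ∀ᵐ x ∂(P i), f i x ∈ Set.Icc (0 : ℝ) 1) (j : Fin K) :
    Integrable (fun μ : Fin K → ℝ ↦ μ j * ∏ i, f i (μ i)) (jointPrior P) := by
  refine (integrable_prod_jointPrior hf h).bdd_mul (c := 1)
    (measurable_pi_apply j).aestronglyMeasurable ?_
  filter_upwards [ae_jointPrior hP] with μ hμ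
  rw [Real.norm_of_nonneg (hμ j).1.le]
  exact (hμ j).2.le

lemma integrable_eval_jointPrior (hP : ∀ i, ∀ᵐ x ∂(P i), x ∈ Set.Ioo (0 : ℝ) 1) (j : Fin K) :
    Integrable (fun μ : Fin K → ℝ ↦ μ j) (jointPrior P) := by
  simpa using integrable_mul_prod_jointPrior hP (f := fun _ _ ↦ 1) (by fun_prop) (by simp) j

lemma integrable_mixReward (hP : ∀ i, ∀ᵐ x ∂(P i), x ∈ Set.Ioo (0 : ℝ) 1) (q : Fin K → ℝ) :
    Integrable (mixReward q) (jointPrior P) :=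
  integrable_finsetSum _ fun i _ ↦ (integrable_eval_jointPrior hP i).const_mul _

lemma integrable_max_sub_mixReward (hP : ∀ i, ∀ᵐ x ∂(P i), x ∈ Set.Ioo (0 : ℝ) 1)
    (q : Fin K → ℝ) (j : Fin K) :
    Integrable (fun μ : Fin K → ℝ ↦ max (μ j - mixReward q μ) 0) (jointPrior P) :=
  ((integrable_eval_jointPrior hP j).sub (integrable_mixReward hP q)).pos_part

/-- The part of the expectation coming from large values of `μ j` alone. -/
lemma mul_sub_le_integral_max_sub_mixReward (hP : ∀ i, ∀ᵐ x ∂(P i), x ∈ Set.Ioo (0 : ℝ) 1)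
    {q : Fin K → ℝ} {j : Fin K} (hqj : q j = 0) (s : ℝ) :
    (P j).real (Set.Ioi s) * (s - mixReward q fun i ↦ priorMean (P i)) ≤
      ∫ μ, max (μ j - mixReward q μ) 0 ∂(jointPrior P) := by
  classical
  -- The product of the `f i` is the indicator of `μ j > s`, written so that independence factors
  -- each integral. As `q j = 0`, the one term correlated with it drops out of `μ_q`.
  set f : Fin K → ℝ → ℝ := fun i ↦ if i = j then (Set.Ioi s).indicator 1 else fun _ ↦ 1 with hf
  have hfm : ∀ i, Measurable (f i) := fun i ↦ by
    by_cases h : i = j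
    · simpa [hf, h] using measurable_one.indicator measurableSet_Ioi
    · simp [hf, h]
  have hf01 : ∀ i x, f i x ∈ Set.Icc (0 : ℝ) 1 := fun i x ↦ by
    by_cases h : i = j <;> by_cases hx : s < x <;> simp [hf, h, hx, Set.indicator]
  have hprod : ∀ μ : Fin K → ℝ, ∏ i, f i (μ i) = (Set.Ioi s).indicator 1 (μ j) := fun μ ↦ by
    rw [Finset.prod_eq_single j] <;> simp +contextual [hf]
  have hfint : ∀ i, ∫ x, f i x ∂(P i) = if i = j then (P j).real (Set.Ioi s) else 1 := fun i ↦ by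
    by_cases h : i = j
    · subst h
      simp only [hf, if_true]
      exact integral_indicator_one measurableSet_Ioi
    · simp [hf, h]
  have hw : ∫ μ, ∏ i, f i (μ i) ∂(jointPrior P) = (P j).real (Set.Ioi s) := by
    rw [integral_prod_jointPrior]; simp [hfint]
  have hmean : ∀ i, q i * ∫ μ, μ i * ∏ k, f k (μ k) ∂(jointPrior P) =
      (P j).real (Set.Ioi s) * (q i * priorMean (P i)) := fun i ↦ by
    by_cases h : i = j
    · simp [h, hqj]
    · have hfi : f i = fun _ ↦ 1 := by simp [hf, h]
      rw [integral_mul_prod_jointPrior, hfi]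
      simp only [hfint, mul_one, Finset.prod_ite_eq', Finset.mem_erase, Finset.mem_univ, and_true,
        Ne.symm h, ne_eq, not_false_eq_true, if_true]
      rw [priorMean]
      ring
  have hwi := integrable_prod_jointPrior hfm (P := P) fun i ↦ .of_forall (hf01 i)
  have hmi := fun i ↦ integrable_mul_prod_jointPrior hP hfm (fun i ↦ .of_forall (hf01 i)) i
  have hi2 : Integrable (fun μ : Fin K → ℝ ↦ ∑ i, q i * (μ i * ∏ k, f k (μ k)))
      (jointPrior P) := integrable_finsetSum _ fun i _ ↦ (hmi i).const_mul _
  calc (P j).real (Set.Ioi s) * (s - mixReward q fun i ↦ priorMean (P i))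
      = ∫ μ, (s * ∏ k, f k (μ k) - ∑ i, q i * (μ i * ∏ k, f k (μ k))) ∂(jointPrior P) := by
        rw [integral_sub (hwi.const_mul _) hi2,
          integral_finsetSum _ fun i _ ↦ (hmi i).const_mul _]
        simp_rw [integral_const_mul, hmean, hw, ← Finset.mul_sum, mixReward]
        ring
    _ ≤ _ := by
        refine integral_mono ((hwi.const_mul _).sub hi2) (integrable_max_sub_mixReward hP q j)
          fun μ ↦ ?_
        -- Pointwise, `(s - μ_q) 1{μ_j > s} ≤ (μ_j - μ_q)₊`.
        have : s * ∏ k, f k (μ k) - ∑ i, q i * (μ i * ∏ k, f k (μ k)) =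
            (s - mixReward q μ) * (Set.Ioi s).indicator 1 (μ j) := by
          simp_rw [hprod, mixReward, sub_mul, Finset.sum_mul, mul_assoc]
        dsimp only
        rw [this]
        by_cases h : s < μ j
        · simp only [Set.indicator, Set.mem_Ioi, h, if_true, Pi.one_apply, mul_one]
          exact le_max_of_le_left (by linarith)
        · simp [Set.indicator, h]

/-- The part of the expectation coming from small values of all arms in the support of `q`. -/
lemma prod_mul_sub_le_integral_max_sub_mixReward
    (hP : ∀ i, ∀ᵐ x ∂(P i), x ∈ Set.Ioo (0 : ℝ) 1)
    {q : Fin K → ℝ} {j : Fin K} {S : Finset (Fin K)} (hq : q ∈ stdSimplex ℝ (Fin K))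
    (hqS : ∀ i ∉ S, q i = 0) (hjS : j ∉ S) (t : ℝ) :
    (∏ i ∈ S, (P i).real (Set.Iio t)) * (priorMean (P j) - t) ≤
      ∫ μ, max (μ j - mixReward q μ) 0 ∂(jointPrior P) := by
  classical
  -- Here the product is the indicator that all arms of `S` lie below `t`. On that event `μ_q ≤ t`,
  -- and `j ∉ S` keeps `μ_j` independent of it.
  set f : Fin K → ℝ → ℝ := fun i ↦ if i ∈ S then (Set.Iio t).indicator 1 else fun _ ↦ 1 with hf
  have hfm : ∀ i, Measurable (f i) := fun i ↦ by
    by_cases h : i ∈ S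
    · simpa [hf, h] using measurable_one.indicator measurableSet_Iio
    · simp [hf, h]
  have hf01 : ∀ i x, f i x ∈ Set.Icc (0 : ℝ) 1 := fun i x ↦ by
    by_cases h : i ∈ S <;> by_cases hx : x < t <;> simp [hf, h, hx, Set.indicator]
  have hfint : ∀ i, ∫ x, f i x ∂(P i) = if i ∈ S then (P i).real (Set.Iio t) else 1 := fun i ↦ by
    by_cases h : i ∈ S
    · simp only [hf, h, if_true]
      exact integral_indicator_one measurableSet_Iio
    · simp [hf, h]
  have hprod : ∀ g : Fin K → ℝ, (∏ i ∈ S, g i) = ∏ i, if i ∈ S then g i else 1 := fun g ↦ by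
    simp [Finset.prod_ite_mem]
  have hw : ∫ μ, ∏ i, f i (μ i) ∂(jointPrior P) = ∏ i ∈ S, (P i).real (Set.Iio t) := by
    rw [integral_prod_jointPrior, hprod]; simp_rw [hfint]
  have hmean : ∫ μ, μ j * ∏ k, f k (μ k) ∂(jointPrior P) =
      priorMean (P j) * ∏ i ∈ S, (P i).real (Set.Iio t) := by
    have hfj : f j = fun _ ↦ 1 := by simp [hf, hjS]
    rw [integral_mul_prod_jointPrior, hprod, ← Finset.mul_prod_erase _ _ (Finset.mem_univ j), hfj]
    simp only [hfint, hjS, mul_one, one_mul, if_false]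
    rfl
  have hwi := integrable_prod_jointPrior hfm (P := P) fun i ↦ .of_forall (hf01 i)
  have hmi := integrable_mul_prod_jointPrior hP hfm (fun i ↦ .of_forall (hf01 i)) j
  calc (∏ i ∈ S, (P i).real (Set.Iio t)) * (priorMean (P j) - t)
      = ∫ μ, (μ j * ∏ k, f k (μ k) - t * ∏ k, f k (μ k)) ∂(jointPrior P) := by
        rw [integral_sub hmi (hwi.const_mul _), integral_const_mul, hmean, hw]
        ring
    _ ≤ _ := by
        refine integral_mono (hmi.sub (hwi.const_mul _)) (integrable_max_sub_mixReward hP q j)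
          fun μ ↦ ?_
        dsimp only
        rw [← sub_mul]
        by_cases h : ∀ i ∈ S, μ i < t
        · have h1 : ∏ k, f k (μ k) = 1 := Finset.prod_eq_one fun i _ ↦ by
            by_cases hi : i ∈ S
            · simp [hf, hi, h i hi]
            · simp [hf, hi]
          have h2 : mixReward q μ ≤ t := by
            calc mixReward q μ ≤ ∑ i, q i * t := by
                  refine Finset.sum_le_sum fun i _ ↦ ?_
                  by_cases hi : i ∈ S
                  · exact mul_le_mul_of_nonneg_left (h i hi).le (hq.1 i)
                  · simp [hqS i hi]
              _ = t := by rw [← Finset.sum_mul, hq.2, one_mul]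
          rw [h1, mul_one]
          exact le_max_of_le_left (by linarith)
        · push Not at h
          obtain ⟨i, hi, hit⟩ := h
          have h1 : ∏ k, f k (μ k) = 0 :=
            Finset.prod_eq_zero (Finset.mem_univ i) (by simp [hf, hi, hit])
          simp [h1]

lemma prod_le_jointPrior_bestArmEvent (i : Fin K) (t : ℝ) :
    (P i).real (Set.Ioi t) * ∏ k ∈ Finset.univ.erase i, (P k).real (Set.Iio t) ≤
      (jointPrior P).real (bestArmEvent i) := by
  classical
  set T : Fin K → Set ℝ := fun k ↦ if k = i then Set.Ioi t else Set.Iio t with hT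
  have h1 : (jointPrior P).real (Set.univ.pi T) =
      (P i).real (Set.Ioi t) * ∏ k ∈ Finset.univ.erase i, (P k).real (Set.Iio t) := by
    rw [measureReal_def, jointPrior, Measure.pi_pi, ENNReal.toReal_prod,
      ← Finset.mul_prod_erase _ _ (Finset.mem_univ i)]
    simp only [hT, if_true, measureReal_def]
    congr 1
    refine Finset.prod_congr rfl fun k hk ↦ ?_
    simp [Finset.ne_of_mem_erase hk]
  rw [← h1]
  refine measureReal_mono fun μ hμ ↦ ?_
  have hi : t < μ i := by simpa [hT] using hμ i trivial
  have hk : ∀ k, k ≠ i → μ k < t := fun k hki ↦ by simpa [hT, hki] using hμ k trivial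
  refine ⟨fun k ↦ ?_, fun k hki ↦ (hk k hki.ne).trans hi⟩
  rcases eq_or_ne k i with rfl | h
  · rfl
  · exact ((hk k h).trans hi).le

end Product

/-! ### One-arm estimates that depend on the mean alone. -/

section Marginal

variable {ν : Measure ℝ} [IsProbabilityMeasure ν]

lemma integrable_id_of_ae_mem_Ioo (h : ∀ᵐ x ∂ν, x ∈ Set.Ioo (0 : ℝ) 1) :
    Integrable (fun x ↦ x) ν := by
  refine Integrable.of_bound (C := 1) aestronglyMeasurable_id ?_
  filter_upwards [h] with x hx
  rw [Real.norm_of_nonneg hx.1.le]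
  exact hx.2.le

/-- Markov-type bound from `x ≤ t + 1{x > t}` on `(0, 1)`. It replaces the beta tail bounds for the
strong arm. -/
lemma priorMean_sub_le_real_Ioi (h : ∀ᵐ x ∂ν, x ∈ Set.Ioo (0 : ℝ) 1) {t : ℝ} (ht : 0 ≤ t) :
    priorMean ν - t ≤ ν.real (Set.Ioi t) := by
  have hi : Integrable ((Set.Ioi t).indicator (1 : ℝ → ℝ)) ν :=
    (integrable_const (1 : ℝ)).indicator measurableSet_Ioi
  have h1 : priorMean ν ≤ ∫ x, (t + (Set.Ioi t).indicator 1 x) ∂ν := by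
    refine integral_mono_ae (integrable_id_of_ae_mem_Ioo h) ?_ ?_
    · exact (integrable_const t).add hi
    · filter_upwards [h] with x hx
      by_cases hxt : t < x
      · simp only [Set.indicator, Set.mem_Ioi, hxt, if_true, Pi.one_apply]
        linarith [hx.2]
      · simp only [Set.indicator, Set.mem_Ioi, hxt, if_false]
        linarith
  rw [integral_add (integrable_const t) hi,
    integral_indicator_one measurableSet_Ioi] at h1
  simp at h1
  linarith

lemma sub_priorMean_le_real_Iio (h : ∀ᵐ x ∂ν, x ∈ Set.Ioo (0 : ℝ) 1) {t : ℝ} (ht : t ≤ 1) :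
    t - priorMean ν ≤ ν.real (Set.Iio t) := by
  have hi : Integrable ((Set.Iio t).indicator (1 : ℝ → ℝ)) ν :=
    (integrable_const (1 : ℝ)).indicator measurableSet_Iio
  have h1 : ∫ x, (t - (Set.Iio t).indicator 1 x) ∂ν ≤ priorMean ν := by
    refine integral_mono_ae ?_ (integrable_id_of_ae_mem_Ioo h) ?_
    · exact (integrable_const t).sub hi
    · filter_upwards [h] with x hx
      by_cases hxt : x < t
      · simp only [Set.indicator, Set.mem_Iio, hxt, if_true, Pi.one_apply]
        linarith [hx.1]
      · simp only [Set.indicator, Set.mem_Iio, hxt, if_false]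
        linarith
  rw [integral_sub (integrable_const t) hi,
    integral_indicator_one measurableSet_Iio] at h1
  simp at h1
  linarith

lemma integrable_one_sub_pow (h : ∀ᵐ x ∂ν, x ∈ Set.Ioo (0 : ℝ) 1) (n : ℕ) :
    Integrable (fun x ↦ (1 - x) ^ n) ν := by
  refine Integrable.of_bound (C := 1) (by fun_prop) ?_
  filter_upwards [h] with x hx
  have h0 : 0 ≤ 1 - x := by linarith [hx.2]
  rw [Real.norm_of_nonneg (pow_nonneg h0 n)]
  exact pow_le_one₀ h0 (by linarith [hx.1])

/-- Jensen for the convex power: mixing over the mean reward only makes a run of zeros more likely.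
-/
lemma one_sub_priorMean_pow_le (h : ∀ᵐ x ∂ν, x ∈ Set.Ioo (0 : ℝ) 1) (n : ℕ) :
    (1 - priorMean ν) ^ n ≤ ∫ x, (1 - x) ^ n ∂ν := by
  have h1 := (convexOn_pow n).map_integral_le (μ := ν) (f := fun x ↦ 1 - x)
    (continuous_pow n).continuousOn isClosed_Ici
    (by filter_upwards [h] with x hx; simpa using hx.2.le)
    ((integrable_const (1 : ℝ)).sub (integrable_id_of_ae_mem_Ioo h))
    (integrable_one_sub_pow h n)
  rw [integral_sub (integrable_const _) (integrable_id_of_ae_mem_Ioo h)] at h1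
  simpa [priorMean] using h1

end Marginal

end IncentivizedExploration

namespace IncentivizedExploration

/-! ### The all-zeros event and the posterior means given it. -/

section Zeros

variable {K : ℕ} {P : Fin K → Measure ℝ} [∀ i, IsProbabilityMeasure (P i)]

instance isProbabilityMeasure_rewardModel : IsProbabilityMeasure (rewardModel P) := by
  unfold rewardModel; infer_instance

lemma reward_eq_zero_iff (i : Fin K) (n : ℕ) (ω : (Fin K → ℝ) × (Fin K × ℕ → unitInterval)) :
    reward i n ω = 0 ↔ ω.1 i ≤ ω.2 (i, n) := by
  simp [reward]

lemma zerosEvent_anti (j : Fin K) {N N' : ℕ} (h : N ≤ N') : zerosEvent j N' ⊆ zerosEvent j N :=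
  fun _ hω i hi n hn ↦ hω i hi n (hn.trans_le h)

lemma measurableSet_zerosEvent (j : Fin K) (N : ℕ) : MeasurableSet (zerosEvent j N) := by
  have : zerosEvent j N = ⋂ (i : Fin K) (_ : i < j) (n : ℕ) (_ : n < N),
      {ω : (Fin K → ℝ) × (Fin K × ℕ → unitInterval) | ω.1 i ≤ ω.2 (i, n)} := by
    ext ω
    simp [zerosEvent, reward_eq_zero_iff]
  rw [this]
  refine .iInter fun i ↦ .iInter fun _ ↦ .iInter fun n ↦ .iInter fun _ ↦ ?_
  exact measurableSet_le (by fun_prop) (by fun_prop)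

/-- The factor which arm `i` contributes to the conditional probability of `zerosEvent j N`, given
that its mean reward is `x`. -/
def zerosWeight (j : Fin K) (N : ℕ) (i : Fin K) (x : ℝ) : ℝ := if i < j then (1 - x) ^ N else 1

lemma measurable_zerosWeight (j : Fin K) (N : ℕ) (i : Fin K) : Measurable (zerosWeight j N i) := by
  unfold zerosWeight
  split_ifs <;> fun_prop

lemma zerosWeight_mem_Icc (j : Fin K) (N : ℕ) (i : Fin K) {x : ℝ} (hx : x ∈ Set.Ioo (0 : ℝ) 1) :
    zerosWeight j N i x ∈ Set.Icc (0 : ℝ) 1 := by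
  have h0 : 0 ≤ 1 - x := by linarith [hx.2]
  unfold zerosWeight
  split_ifs
  · exact ⟨pow_nonneg h0 N, pow_le_one₀ h0 (by linarith [hx.1])⟩
  · simp

/-- The conditional probability of `zerosEvent j N` given the mean rewards. -/
lemma infinitePi_zerosEvent_section (j : Fin K) (N : ℕ) {μ : Fin K → ℝ}
    (hμ : ∀ i, μ i ∈ Set.Ioo (0 : ℝ) 1) :
    (Measure.infinitePi fun _ : Fin K × ℕ ↦ (volume : Measure unitInterval)).real
      {u | (μ, u) ∈ zerosEvent j N} = ∏ i, zerosWeight j N i (μ i) := by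
  classical
  set x : Fin K → unitInterval := fun i ↦ ⟨μ i, (hμ i).1.le, (hμ i).2.le⟩ with hx
  -- For fixed means the event is a finite cylinder: each relevant seed of arm `i` must lie in `[μ
  -- i, 1]`, an interval of length `1 - μ i`.
  have h1 : {u : Fin K × ℕ → unitInterval | (μ, u) ∈ zerosEvent j N} =
      Set.pi ((Finset.univ.filter (· < j)) ×ˢ Finset.range N : Finset (Fin K × ℕ))
        fun k ↦ Set.Ici (x k.1) := by
    ext u
    simp only [zerosEvent, reward_eq_zero_iff, Set.mem_ofPred_eq, Set.mem_pi, Finset.mem_coe,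
      Finset.mem_product, Finset.mem_filter, Finset.mem_univ, true_and, Finset.mem_range,
      Set.mem_Ici, Prod.forall, hx, ← Subtype.coe_le_coe, and_imp]
    exact ⟨fun h i n hi hn ↦ h i hi n hn, fun h i hi n hn ↦ h i n hi hn⟩
  rw [measureReal_def, h1, Measure.infinitePi_pi _ fun _ _ ↦ measurableSet_Ici,
    ENNReal.toReal_prod, Finset.prod_product, Finset.prod_filter]
  refine Finset.prod_congr rfl fun i _ ↦ ?_
  have : 0 ≤ 1 - μ i := by linarith [(hμ i).2]
  simp [zerosWeight, hx, ENNReal.toReal_ofReal this]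

lemma setIntegral_zerosEvent (hP : ∀ i, ∀ᵐ x ∂(P i), x ∈ Set.Ioo (0 : ℝ) 1) (j : Fin K) (N : ℕ)
    {g : (Fin K → ℝ) → ℝ} (hg : Integrable g (jointPrior P)) :
    ∫ ω in zerosEvent j N, g ω.1 ∂(rewardModel P) =
      ∫ μ, g μ * ∏ i, zerosWeight j N i (μ i) ∂(jointPrior P) := by
  have hZ := measurableSet_zerosEvent j N
  rw [← integral_indicator hZ, rewardModel,
    integral_prod _ ((hg.comp_fst _).indicator hZ)]
  refine integral_congr_ae ?_
  filter_upwards [ae_jointPrior hP] with μ hμ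
  rw [← infinitePi_zerosEvent_section j N hμ]
  have h1 : ∀ u, (zerosEvent j N).indicator (fun ω ↦ g ω.1) (μ, u) =
      {u | (μ, u) ∈ zerosEvent j N}.indicator (fun _ ↦ g μ) u := fun u ↦ rfl
  have hs : MeasurableSet {u | (μ, u) ∈ zerosEvent j N} := measurable_prodMk_left hZ
  simp_rw [h1]
  rw [integral_indicator_const _ hs, smul_eq_mul, mul_comm]

lemma rewardModel_real_zerosEvent (hP : ∀ i, ∀ᵐ x ∂(P i), x ∈ Set.Ioo (0 : ℝ) 1) (j : Fin K)
    (N : ℕ) : (rewardModel P).real (zerosEvent j N) = ∏ i, ∫ x, zerosWeight j N i x ∂(P i) := by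
  have h := setIntegral_zerosEvent hP j N (integrable_const (1 : ℝ))
  simp only [setIntegral_const, smul_eq_mul, mul_one, one_mul] at h
  rw [h, integral_prod_jointPrior]

lemma integral_zerosWeight_pos (hP : ∀ i, ∀ᵐ x ∂(P i), x ∈ Set.Ioo (0 : ℝ) 1)
    (h1 : ∀ i, priorMean (P i) < 1) (j : Fin K) (N : ℕ) (i : Fin K) :
    0 < ∫ x, zerosWeight j N i x ∂(P i) := by
  unfold zerosWeight
  split_ifs
  · exact (pow_pos (sub_pos.2 (h1 i)) N).trans_le (one_sub_priorMean_pow_le (hP i) N)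
  · simp

/-- A uniform lower bound for the probability of seeing only zeros. -/
lemma pow_le_rewardModel_real_zerosEvent (hP : ∀ i, ∀ᵐ x ∂(P i), x ∈ Set.Ioo (0 : ℝ) 1)
    {r : ℝ} (hr : 0 ≤ r) (hr1 : r ≤ 1) (h1 : ∀ i, priorMean (P i) ≤ 1 - r) (j : Fin K) (N : ℕ) :
    r ^ (N * K) ≤ (rewardModel P).real (zerosEvent j N) := by
  rw [rewardModel_real_zerosEvent hP, pow_mul]
  calc (r ^ N) ^ K = ∏ _i : Fin K, r ^ N := by simp
    _ ≤ _ := by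
      refine Finset.prod_le_prod (fun _ _ ↦ pow_nonneg hr N) fun i _ ↦ ?_
      unfold zerosWeight
      split_ifs
      · refine le_trans (pow_le_pow_left₀ hr ?_ N) (one_sub_priorMean_pow_le (hP i) N)
        linarith [h1 i]
      · simpa using pow_le_one₀ hr hr1

/-- For beta priors, the condition on the bootstrapping phase holds as soon as the posterior means
of the arms with all-zero samples lie below all prior means. -/
lemma bootCondition_of_betaMeasure {a b : Fin K → ℝ} (hab : ∀ i, 0 < a i ∧ 0 < b i)
    (hPab : ∀ i, P i = betaMeasure (a i) (b i)) {N : ℕ}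
    (hN : ∀ i j, a i / (a i + b i + N) < priorMean (P j)) : BootCondition P N := by
  have hP : ∀ i, ∀ᵐ x ∂(P i), x ∈ Set.Ioo (0 : ℝ) 1 := fun i ↦ by
    rw [hPab i]; exact ae_betaMeasure_mem_Ioo
  have hmean : ∀ i, priorMean (P i) < 1 := fun i ↦ by
    rw [hPab i, priorMean, integral_id_betaMeasure (hab i).1 (hab i).2,
      div_lt_one (add_pos (hab i).1 (hab i).2)]
    linarith [(hab i).2]
  intro i j hij
  set I : Fin K → ℝ := fun k ↦ ∫ x, zerosWeight j N k x ∂(P k) with hI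
  have hIpos : 0 < ∏ k, I k := Finset.prod_pos fun k _ ↦ integral_zerosWeight_pos hP hmean j N k
  have hint : Integrable (fun μ : Fin K → ℝ ↦ μ j - μ i) (jointPrior P) :=
    (integrable_eval_jointPrior hP j).sub (integrable_eval_jointPrior hP i)
  have hprob : (rewardModel P).real (zerosEvent j N) = ∏ k, I k :=
    rewardModel_real_zerosEvent hP j N
  have hw : ∀ k, ∀ᵐ x ∂(P k), zerosWeight j N k x ∈ Set.Icc (0 : ℝ) 1 := fun k ↦ by
    filter_upwards [hP k] with x hx using zerosWeight_mem_Icc j N k hx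
  -- Arm `j` has weight 1 in its own event, so its posterior mean is its prior mean; arm `i < j` is
  -- updated by conjugacy.
  have hj : ∫ μ, μ j * ∏ k, zerosWeight j N k (μ k) ∂(jointPrior P) =
      priorMean (P j) * ∏ k, I k := by
    rw [integral_mul_prod_jointPrior, ← Finset.mul_prod_erase _ _ (Finset.mem_univ j)]
    simp [hI, zerosWeight, priorMean]
  have hi : ∫ μ, μ i * ∏ k, zerosWeight j N k (μ k) ∂(jointPrior P) =
      a i / (a i + b i + N) * ∏ k, I k := by
    rw [integral_mul_prod_jointPrior, ← Finset.mul_prod_erase _ _ (Finset.mem_univ i),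
      ← mul_assoc]
    simp only [hI, zerosWeight, hij, if_true]
    rw [hPab i, integral_mul_one_sub_pow_betaMeasure (hab i).1 (hab i).2]
  rw [ProbabilityTheory.cond, integral_smul_measure,
    setIntegral_zerosEvent hP j N (g := fun μ ↦ μ j - μ i) hint]
  simp_rw [sub_mul]
  rw [integral_sub (integrable_mul_prod_jointPrior hP (measurable_zerosWeight j N) hw j)
    (integrable_mul_prod_jointPrior hP (measurable_zerosWeight j N) hw i), hj, hi, ← sub_mul,
    ENNReal.toReal_inv, ← measureReal_def, hprob, smul_eq_mul]
  exact mul_pos (inv_pos.2 hIpos) (mul_pos (sub_pos.2 (hN i j)) hIpos)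

end Zeros

end IncentivizedExploration

/-! ### Quantitative bounds for beta priors with a single strong arm. -/

namespace IncentivizedExploration

lemma mixReward_single {K : ℕ} (j : Fin K) (μ : Fin K → ℝ) :
    mixReward (Pi.single j 1) μ = μ j := by
  simp [mixReward, Pi.single_apply]

lemma mixReward_le {K : ℕ} {q μ : Fin K → ℝ} (hq : q ∈ stdSimplex ℝ (Fin K)) {u : ℝ}
    (h : ∀ i, μ i ≤ u) : mixReward q μ ≤ u := by
  calc mixReward q μ ≤ ∑ i, q i * u :=
        Finset.sum_le_sum fun i _ ↦ mul_le_mul_of_nonneg_left (h i) (hq.1 i)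
    _ = u := by rw [← Finset.sum_mul, hq.2, one_mul]

/-- Beta priors all of whose arms but `ℓ` are weak, together with a number `X` that controls their
strengths and all prior means. -/
structure BetaBandit {K : ℕ} (P : Fin K → Measure ℝ) (a b : Fin K → ℝ) (ℓ : Fin K)
    (M m X : ℝ) : Prop where
  two_le_K : 2 ≤ K
  two_le_m : 2 ≤ m
  m_le_M : m ≤ M
  m_le_X : m ≤ X
  eq_beta : ∀ i, P i = betaMeasure (a i) (b i)
  pos : ∀ i, 0 < a i ∧ 0 < b i
  one_le : ∀ i, i ≠ ℓ → 1 ≤ a i ∧ 1 ≤ b i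
  strength_le : ∀ i, i ≠ ℓ → a i + b i ≤ m
  strength_eq : a ℓ + b ℓ = M
  le_priorMean : ∀ i, X⁻¹ ≤ priorMean (P i)
  priorMean_le : ∀ i, priorMean (P i) ≤ 1 - X⁻¹
  le_priorMean_pow : X⁻¹ ≤ priorMean (P ℓ) ^ (ℓ : ℕ)

namespace BetaBandit

variable {K : ℕ} {P : Fin K → Measure ℝ} {a b : Fin K → ℝ} {ℓ : Fin K} {M m X : ℝ}

lemma isProbabilityMeasure (h : BetaBandit P a b ℓ M m X) (i : Fin K) :
    IsProbabilityMeasure (P i) := by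
  rw [h.eq_beta i]; exact isProbabilityMeasureBeta (h.pos i).1 (h.pos i).2

lemma ae_mem (h : BetaBandit P a b ℓ M m X) (i : Fin K) : ∀ᵐ x ∂(P i), x ∈ Set.Ioo (0 : ℝ) 1 := by
  rw [h.eq_beta i]; exact ae_betaMeasure_mem_Ioo

lemma two_le_X (h : BetaBandit P a b ℓ M m X) : 2 ≤ X := h.two_le_m.trans h.m_le_X

lemma X_pos (h : BetaBandit P a b ℓ M m X) : 0 < X := by linarith [h.two_le_X]

lemma K_ge (h : BetaBandit P a b ℓ M m X) : (2 : ℝ) ≤ K := by exact_mod_cast h.two_le_K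

lemma rpow_le_real_Iio (h : BetaBandit P a b ℓ M m X) {i : Fin K} (hi : i ≠ ℓ) {t : ℝ}
    (ht : 0 < t) (ht1 : t ≤ 1) : t ^ m ≤ (P i).real (Set.Iio t) := by
  rw [h.eq_beta i]
  refine le_trans ?_ (rpow_le_betaMeasure_real_Iio (h.pos i).1 (h.one_le i hi).2 ht ht1)
  exact Real.rpow_le_rpow_of_exponent_ge ht ht1
    (by linarith [h.strength_le i hi, (h.pos i).2])

lemma rpow_le_real_Ioi (h : BetaBandit P a b ℓ M m X) {i : Fin K} (hi : i ≠ ℓ) {t : ℝ}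
    (ht : 0 < t) (ht1 : t ≤ 1) : t ^ m ≤ (P i).real (Set.Ioi (1 - t)) := by
  rw [h.eq_beta i]
  refine le_trans ?_ (rpow_le_betaMeasure_real_Ioi (h.one_le i hi).1 (h.pos i).2 ht ht1)
  exact Real.rpow_le_rpow_of_exponent_ge ht ht1
    (by linarith [h.strength_le i hi, (h.pos i).1])

lemma sq_le_rpow (h : BetaBandit P a b ℓ M m X) : X ^ 2 ≤ X ^ m := by
  rw [← Real.rpow_natCast]
  exact Real.rpow_le_rpow_of_exponent_le (by linarith [h.two_le_X]) (by exact_mod_cast h.two_le_m)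

lemma four_le_rpow (h : BetaBandit P a b ℓ M m X) : 4 ≤ X ^ m := by
  nlinarith [h.sq_le_rpow, h.two_le_X]

lemma inv_le_inv_two_mul (h : BetaBandit P a b ℓ M m X) : (X ^ m)⁻¹ ≤ (2 * X)⁻¹ := by
  have := h.two_le_X
  have := h.sq_le_rpow
  exact inv_anti₀ (by linarith) (by nlinarith)

lemma inv_sq_le_rpow_inv (h : BetaBandit P a b ℓ M m X) :
    ((X ^ m) ^ 2)⁻¹ ≤ (2 * X)⁻¹ ^ m := by
  have hX := h.two_le_X
  have h1 : (2 * X) ^ m ≤ (X ^ m) ^ 2 := by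
    rw [Real.mul_rpow (by norm_num) h.X_pos.le, sq]
    have : (2 : ℝ) ^ m ≤ X ^ m := Real.rpow_le_rpow (by norm_num) hX (by linarith [h.two_le_m])
    have := h.four_le_rpow
    gcongr
  rw [Real.inv_rpow (by linarith)]
  exact inv_anti₀ (Real.rpow_pos_of_pos (by linarith) _) h1

/-- The right side is the form both kinds of gap take: a probability `(2X)⁻¹ ^ m` times a margin
`(2X)⁻¹`. -/
lemma inv_cube_le (h : BetaBandit P a b ℓ M m X) :
    ((X ^ m) ^ 3)⁻¹ ≤ (2 * X)⁻¹ ^ m * (2 * X)⁻¹ := by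
  have h1 := h.inv_sq_le_rpow_inv
  have h2 := h.inv_le_inv_two_mul
  have h3 := h.four_le_rpow
  have h4 := h.two_le_X
  calc ((X ^ m) ^ 3)⁻¹ = ((X ^ m) ^ 2)⁻¹ * (X ^ m)⁻¹ := by rw [← mul_inv]; ring_nf
    _ ≤ _ := by gcongr

lemma inv_two_mul_pos (h : BetaBandit P a b ℓ M m X) : 0 < (2 * X)⁻¹ := by
  have := h.X_pos; positivity

lemma inv_two_mul_add_self (h : BetaBandit P a b ℓ M m X) : (2 * X)⁻¹ + (2 * X)⁻¹ = X⁻¹ := by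
  have := h.X_pos; field_simp; norm_num

lemma inv_two_mul_le_quarter (h : BetaBandit P a b ℓ M m X) : (2 * X)⁻¹ ≤ 1 / 4 := by
  have := h.two_le_X
  rw [one_div]
  exact inv_anti₀ (by norm_num) (by linarith)

/-- Threshold `1 - (2X)⁻¹` for the weak arm `j`: the mixture has prior mean at most `1 - X⁻¹`, which
leaves a margin of `(2X)⁻¹`. -/
lemma inv_cube_le_integral_of_ne (h : BetaBandit P a b ℓ M m X) {q : Fin K → ℝ} {j : Fin K}
    (hj : j ≠ ℓ) (hq : q ∈ stdSimplex ℝ (Fin K)) (hqj : q j = 0) :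
    ((X ^ m) ^ 3)⁻¹ ≤ ∫ μ, max (μ j - mixReward q μ) 0 ∂(jointPrior P) := by
  have := h.isProbabilityMeasure
  have h0 := h.inv_two_mul_pos
  have h1 := h.inv_two_mul_add_self
  have h2 := h.rpow_le_real_Ioi hj h0 (by linarith [h.inv_two_mul_le_quarter])
  have h3 : mixReward q (fun i ↦ priorMean (P i)) ≤ 1 - X⁻¹ := mixReward_le hq h.priorMean_le
  refine h.inv_cube_le.trans (le_trans ?_
    (mul_sub_le_integral_max_sub_mixReward h.ae_mem hqj (1 - (2 * X)⁻¹)))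
  exact mul_le_mul h2 (by linarith) h0.le measureReal_nonneg

/-- With one competitor, the low threshold `(2X)⁻¹` is affordable. With `ℓ` competitors it would
cost a power `ℓ m` of `2X`, hence the finer threshold used for `gPad`. -/
lemma inv_cube_le_integral_strong (h : BetaBandit P a b ℓ M m X) {i : Fin K} (hi : i ≠ ℓ) :
    ((X ^ m) ^ 3)⁻¹ ≤ ∫ μ, max (μ ℓ - mixReward (Pi.single i 1) μ) 0 ∂(jointPrior P) := by
  have := h.isProbabilityMeasure
  have h0 := h.inv_two_mul_pos
  have h1 := h.inv_two_mul_add_self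
  have h2 := h.rpow_le_real_Iio hi h0 (by linarith [h.inv_two_mul_le_quarter])
  refine h.inv_cube_le.trans (le_trans ?_
    (prod_mul_sub_le_integral_max_sub_mixReward h.ae_mem (S := {i})
      (single_mem_stdSimplex ℝ i) (fun k hk ↦ ?_) (by simpa using hi.symm) (2 * X)⁻¹))
  · rw [Finset.prod_singleton]
    exact mul_le_mul h2 (by linarith [h.le_priorMean ℓ]) h0.le measureReal_nonneg
  · simp at hk
    simp [hk]

lemma inv_le_epsTS (h : BetaBandit P a b ℓ M m X) : (K * (X ^ m) ^ 3)⁻¹ ≤ epsTS P := by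
  have h4 := h.four_le_rpow
  have hK := h.two_le_K
  -- The factor `K` is slack here; it gives `epsTS` and `gPad` the same lower bound.
  have hle : (K * (X ^ m) ^ 3)⁻¹ ≤ ((X ^ m) ^ 3)⁻¹ := by
    refine inv_anti₀ (by positivity) (le_mul_of_one_le_left (by positivity) ?_)
    linarith [h.K_ge]
  refine le_csInf ⟨_, ⟨0, by lia⟩, ⟨1, by lia⟩, by simp, rfl⟩ ?_
  rintro _ ⟨i, j, hij, rfl⟩
  refine hle.trans ?_
  simp_rw [← mixReward_single j]
  by_cases hi : i = ℓ
  · subst hi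
    simpa only [mixReward_single] using h.inv_cube_le_integral_strong hij.symm
  · simpa only [mixReward_single] using
      h.inv_cube_le_integral_of_ne hi (single_mem_stdSimplex ℝ j) (by simp [hij])

lemma inv_le_integral_strong_of_mem_simplexBelow (h : BetaBandit P a b ℓ M m X) {q : Fin K → ℝ}
    (hq : q ∈ simplexBelow ℓ) :
    (K * (X ^ m) ^ 3)⁻¹ ≤ ∫ μ, max (μ ℓ - mixReward q μ) 0 ∂(jointPrior P) := by
  have := h.isProbabilityMeasure
  have hK := h.K_ge
  have hX := h.X_pos
  have h0 := h.inv_two_mul_pos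
  set u := priorMean (P ℓ) with hu
  have hu0 : X⁻¹ ≤ u := h.le_priorMean ℓ
  have hupos : 0 < u := (inv_pos.2 hX).trans_le hu0
  have hu1 : u ≤ 1 := by linarith [h.priorMean_le ℓ, inv_pos.2 hX]
  -- The threshold is `u * s`. By Bernoulli's inequality and `ℓ ≤ K`, `s ^ ℓ ≥ 1/2`, while the
  -- margin `u - u * s = u / (2K)` loses only a factor of order `K`.
  set s : ℝ := 1 - ((2 : ℝ) * K)⁻¹ with hs
  have hKi : ((2 : ℝ) * K)⁻¹ ≤ 1 / 4 := by
    rw [one_div]; exact inv_anti₀ (by norm_num) (by linarith)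
  have hKi0 : 0 < ((2 : ℝ) * K)⁻¹ := by positivity
  have hs0 : 0 < s := by linarith
  have hs1 : s ≤ 1 := by linarith
  have hsl : 1 / 2 ≤ s ^ (ℓ : ℕ) := by
    have h1 := one_add_mul_le_pow (a := -((2 : ℝ) * K)⁻¹) (by linarith) (ℓ : ℕ)
    have h2 : ((ℓ : ℕ) : ℝ) * ((2 : ℝ) * K)⁻¹ ≤ K * ((2 : ℝ) * K)⁻¹ := by
      have : ((ℓ : ℕ) : ℝ) ≤ K := by exact_mod_cast ℓ.2.le
      gcongr
    have h3 : (K : ℝ) * ((2 : ℝ) * K)⁻¹ = 1 / 2 := by field_simp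
    rw [hs, sub_eq_add_neg]
    linarith
  have ht0 : 0 < u * s := mul_pos hupos hs0
  have ht1 : u * s ≤ 1 := mul_le_one₀ hu1 hs0.le hs1
  have hprod : (2 * X)⁻¹ ^ m ≤
      ∏ i ∈ Finset.univ.filter (· < ℓ), (P i).real (Set.Iio (u * s)) := by
    -- Since `u ^ ℓ ≥ X⁻¹`, the number of competitors is already absorbed in `X`.
    calc (2 * X)⁻¹ ^ m ≤ ((u * s) ^ (ℓ : ℕ)) ^ m := by
          refine Real.rpow_le_rpow h0.le ?_ (by linarith [h.two_le_m])
          rw [mul_pow, mul_inv, mul_comm]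
          exact mul_le_mul h.le_priorMean_pow (by linarith) (by norm_num) (by positivity)
      _ = ((u * s) ^ m) ^ (ℓ : ℕ) := by
          rw [← Real.rpow_natCast, ← Real.rpow_natCast, ← Real.rpow_mul ht0.le,
            ← Real.rpow_mul ht0.le, mul_comm m]
      _ = ∏ i ∈ Finset.univ.filter (· < ℓ), (u * s) ^ m := by
          rw [Finset.prod_const, Finset.filter_gt_eq_Iio, Fin.card_Iio]
      _ ≤ _ := by
          refine Finset.prod_le_prod (fun _ _ ↦ by positivity) fun i hi ↦ ?_
          exact h.rpow_le_real_Iio (Finset.mem_filter.1 hi).2.ne ht0 ht1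
  have hgap : (2 * X)⁻¹ * (K : ℝ)⁻¹ ≤ u - u * s := by
    have h1 : u - u * s = u * ((2 : ℝ) * K)⁻¹ := by rw [hs]; ring
    rw [h1, mul_inv, mul_inv]
    calc (2 : ℝ)⁻¹ * X⁻¹ * (K : ℝ)⁻¹ = X⁻¹ * (2⁻¹ * (K : ℝ)⁻¹) := by ring
      _ ≤ _ := by gcongr
  refine le_trans ?_ (prod_mul_sub_le_integral_max_sub_mixReward h.ae_mem
    (S := Finset.univ.filter (· < ℓ)) hq.1 (fun k hk ↦ hq.2 k (by simpa using hk)) (by simp)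
    (u * s))
  calc (K * (X ^ m) ^ 3)⁻¹ = ((X ^ m) ^ 3)⁻¹ * (K : ℝ)⁻¹ := by rw [mul_inv, mul_comm]
    _ ≤ (2 * X)⁻¹ ^ m * (2 * X)⁻¹ * (K : ℝ)⁻¹ := by
        gcongr; exact h.inv_cube_le
    _ = (2 * X)⁻¹ ^ m * ((2 * X)⁻¹ * (K : ℝ)⁻¹) := by ring
    _ ≤ _ := mul_le_mul hprod hgap (by positivity)
        (Finset.prod_nonneg fun _ _ ↦ measureReal_nonneg)

lemma inv_le_gPad (h : BetaBandit P a b ℓ M m X) : (K * (X ^ m) ^ 3)⁻¹ ≤ gPad P := by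
  have h4 := h.four_le_rpow
  have hK := h.two_le_K
  have hle : (K * (X ^ m) ^ 3)⁻¹ ≤ ((X ^ m) ^ 3)⁻¹ := by
    refine inv_anti₀ (by positivity) (le_mul_of_one_le_left (by positivity) ?_)
    linarith [h.K_ge]
  refine le_csInf ⟨_, ⟨1, by lia⟩, Pi.single ⟨0, by lia⟩ 1,
    ⟨single_mem_stdSimplex ℝ _, fun i hi ↦ ?_⟩, rfl⟩ ?_
  · refine Pi.single_eq_of_ne (fun h0 ↦ ?_) _
    simp [h0, Fin.le_def] at hi
  rintro _ ⟨j, q, hq, rfl⟩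
  by_cases hj : j = ℓ
  · subst hj
    exact h.inv_le_integral_strong_of_mem_simplexBelow hq
  · exact hle.trans (h.inv_cube_le_integral_of_ne hj hq.1 (hq.2 j le_rfl))

/-- Arm `i` above a threshold and all others below it make `i` best. The threshold is `(2X)⁻¹` for
the strong arm and `1 - (2X)⁻¹` for a weak one, so the strong arm has to clear it only from the side
of its mean, with slack `(2X)⁻¹`. -/
lemma inv_pow_le_deltaTS (h : BetaBandit P a b ℓ M m X) :
    ((X ^ m) ^ (2 * K))⁻¹ ≤ deltaTS P := by
  have := h.isProbabilityMeasure
  have hK := h.two_le_K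
  have h0 := h.inv_two_mul_pos
  have h1 := h.inv_two_mul_add_self
  have h2 := h.inv_two_mul_le_quarter
  have hm := h.two_le_m
  have h4 := h.four_le_rpow
  have : Nonempty (Fin K) := ⟨ℓ⟩
  set r := (2 * X)⁻¹ with hr
  have hrm : r ^ m ≤ r := by
    simpa using Real.rpow_le_rpow_of_exponent_ge h0 (by linarith) (by linarith : (1 : ℝ) ≤ m)
  have key : ∀ (i : Fin K) (t : ℝ), r ^ m ≤ (P i).real (Set.Ioi t) →
      (∀ k, k ≠ i → r ^ m ≤ (P k).real (Set.Iio t)) →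
      ((X ^ m) ^ (2 * K))⁻¹ ≤ (jointPrior P).real (bestArmEvent i) := by
    intro i t hi hk
    refine le_trans ?_ (prod_le_jointPrior_bestArmEvent i t)
    calc ((X ^ m) ^ (2 * K))⁻¹ = (((X ^ m) ^ 2)⁻¹) ^ K := by rw [pow_mul, inv_pow]
      _ ≤ (r ^ m) ^ K := by
          refine pow_le_pow_left₀ (by positivity) h.inv_sq_le_rpow_inv _
      _ = ∏ _k : Fin K, r ^ m := by simp
      _ = r ^ m * ∏ _k ∈ Finset.univ.erase i, r ^ m :=
          (Finset.mul_prod_erase _ _ (Finset.mem_univ i)).symm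
      _ ≤ _ := by
          refine mul_le_mul hi (Finset.prod_le_prod (fun _ _ ↦ by positivity) fun k hk' ↦
            hk k (Finset.ne_of_mem_erase hk')) (by positivity) measureReal_nonneg
  refine le_ciInf fun i ↦ ?_
  by_cases hi : i = ℓ
  · subst hi
    refine key i r (hrm.trans ?_) fun k hk ↦ h.rpow_le_real_Iio hk h0 (by linarith)
    exact le_trans (by linarith [h.le_priorMean i]) (priorMean_sub_le_real_Ioi (h.ae_mem i) h0.le)
  · refine key i (1 - r) (h.rpow_le_real_Ioi hi h0 (by linarith)) fun k _ ↦ ?_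
    by_cases hkℓ : k = ℓ
    · refine hrm.trans (le_trans ?_ (sub_priorMean_le_real_Iio (h.ae_mem k) (by linarith)))
      linarith [h.priorMean_le k]
    · refine le_trans ?_ (h.rpow_le_real_Iio hkℓ (by linarith) (by linarith))
      exact Real.rpow_le_rpow h0.le (by linarith) (by linarith)

/-- With `N ≥ M X` and strengths at most `M`, the posterior mean `a / (a + b + N)` is strictly below
`X⁻¹`, hence below every prior mean. -/
lemma bootCondition (h : BetaBandit P a b ℓ M m X) : BootCondition P ⌈M * X⌉₊ := by
  have := h.isProbabilityMeasure
  have hX := h.X_pos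
  refine bootCondition_of_betaMeasure h.pos h.eq_beta fun i j ↦ ?_
  have ⟨ha, hb⟩ := h.pos i
  have hM : a i + b i ≤ M := by
    by_cases hi : i = ℓ
    · rw [hi, h.strength_eq]
    · exact (h.strength_le i hi).trans h.m_le_M
  have hc := Nat.le_ceil (M * X)
  refine lt_of_lt_of_le ?_ (h.le_priorMean j)
  rw [div_lt_iff₀ (by positivity), inv_mul_eq_div, lt_div_iff₀ hX]
  nlinarith

lemma nBoot_le (h : BetaBandit P a b ℓ M m X) : nBoot P ≤ ⌈M * X⌉₊ := Nat.sInf_le h.bootCondition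

lemma ceil_le (h : BetaBandit P a b ℓ M m X) : (⌈M * X⌉₊ : ℝ) ≤ 2 * M * X := by
  have := h.two_le_X
  have : 2 ≤ M := h.two_le_m.trans h.m_le_M
  have := Nat.ceil_lt_add_one (a := M * X) (by nlinarith)
  nlinarith

lemma inv_pow_le_pBoot (h : BetaBandit P a b ℓ M m X) :
    X⁻¹ ^ (⌈M * X⌉₊ * K) ≤ pBoot P := by
  have := h.isProbabilityMeasure
  have : Nonempty (Fin K) := ⟨ℓ⟩
  have hX := h.X_pos
  refine le_ciInf fun j ↦ le_trans ?_
    (measureReal_mono (zerosEvent_anti j h.nBoot_le))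
  exact pow_le_rewardModel_real_zerosEvent h.ae_mem (by positivity)
    (inv_le_one_of_one_le₀ (by linarith [h.two_le_X])) h.priorMean_le j _

lemma wellDefined (h : BetaBandit P a b ℓ M m X) : WellDefined P := by
  have hX := h.X_pos
  have hK := h.K_ge
  have hY := h.four_le_rpow
  exact ⟨lt_of_lt_of_le (by positivity) h.inv_le_epsTS,
    lt_of_lt_of_le (by positivity) h.inv_pow_le_deltaTS,
    lt_of_lt_of_le (by positivity) h.inv_le_gPad, ⟨_, h.bootCondition⟩,
    lt_of_lt_of_le (by positivity) h.inv_pow_le_pBoot⟩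

lemma log_inv_deltaTS_le (h : BetaBandit P a b ℓ M m X) :
    Real.log (deltaTS P)⁻¹ ≤ K * (X ^ m) ^ 3 := by
  have hY := h.four_le_rpow
  have hδ := h.wellDefined.deltaTS_pos
  calc Real.log (deltaTS P)⁻¹ ≤ Real.log ((X ^ m) ^ (2 * K)) := by
        refine Real.log_le_log (inv_pos.2 hδ) ?_
        exact inv_le_of_inv_le₀ (by positivity) h.inv_pow_le_deltaTS
    _ = K * (2 * Real.log (X ^ m)) := by rw [Real.log_pow]; push_cast; ring
    _ ≤ K * (2 * X ^ m) := by
        have := Real.log_le_self (by linarith : 0 ≤ X ^ m)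
        gcongr
    _ ≤ K * (X ^ m) ^ 3 := by
        have : 2 * X ^ m ≤ (X ^ m) ^ 3 := by
          nlinarith [mul_nonneg (by linarith : 0 ≤ X ^ m) (by nlinarith : 0 ≤ (X ^ m) ^ 2 - 2)]
        gcongr

lemma log_inv_pBoot_le (h : BetaBandit P a b ℓ M m X) :
    Real.log (pBoot P)⁻¹ ≤ 2 * M * (K * (X ^ m) ^ 3) := by
  have hX := h.X_pos
  have hY := h.four_le_rpow
  have hM : 2 ≤ M := h.two_le_m.trans h.m_le_M
  calc Real.log (pBoot P)⁻¹ ≤ Real.log (X ^ (⌈M * X⌉₊ * K)) := by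
        refine Real.log_le_log (inv_pos.2 h.wellDefined.pBoot_pos) ?_
        refine inv_le_of_inv_le₀ (by positivity) ?_
        simpa using h.inv_pow_le_pBoot
    _ = ⌈M * X⌉₊ * K * Real.log X := by rw [Real.log_pow]; push_cast; ring
    _ ≤ (2 * M * X) * K * X := by
        have := Real.log_le_self hX.le
        have := Real.log_nonneg (by linarith [h.two_le_X] : 1 ≤ X)
        have := h.ceil_le
        gcongr
    _ = 2 * M * (K * X ^ 2) := by ring
    _ ≤ 2 * M * (K * (X ^ m) ^ 3) := by
        have := h.sq_le_rpow
        have : X ^ m ≤ (X ^ m) ^ 3 := le_self_pow₀ (by linarith) (by norm_num)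
        gcongr
        linarith

/-- With `D = K Y³`, the maximum of the sample counts contributes `D³`, while `G_pad⁻¹` and the
logarithm contribute `D` each. One factor `M` comes from `nBoot`, the other from `log p_boot⁻¹`. -/
lemma rndsUB_le (h : BetaBandit P a b ℓ M m X) {CTS Cpad CUB : ℝ} (hCTS : 0 < CTS)
    (hCpad : 0 < Cpad) (hCUB : 0 < CUB) :
    rndsUB CUB Cpad P (nTS CTS P) ≤
      3 * CUB * (CTS + Cpad + 2) * M ^ 2 * K * (K * (X ^ m) ^ 3) ^ 5 := by
  have hw := h.wellDefined
  have hX := h.X_pos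
  have hY := h.four_le_rpow
  have hK := h.K_ge
  have hM : 2 ≤ M := h.two_le_m.trans h.m_le_M
  set D : ℝ := K * (X ^ m) ^ 3 with hD
  have hD1 : 1 ≤ D := by
    have : 1 ≤ (X ^ m) ^ 3 := one_le_pow₀ (by linarith)
    nlinarith
  have hε : (epsTS P)⁻¹ ≤ D := inv_le_of_inv_le₀ (by positivity) h.inv_le_epsTS
  have hG : (gPad P)⁻¹ ≤ D := inv_le_of_inv_le₀ (by positivity) h.inv_le_gPad
  have hε0 := inv_pos.2 hw.epsTS_pos
  have hG0 := inv_pos.2 hw.gPad_pos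
  have hp0 := inv_pos.2 hw.pBoot_pos
  have hlogG : Real.log (gPad P)⁻¹ ≤ D := (Real.log_le_self hG0.le).trans hG
  have hXD : X ≤ D ^ 3 := by
    have h1 : X ≤ X ^ m := by nlinarith [h.sq_le_rpow, h.two_le_X]
    have h2 : X ^ m ≤ (X ^ m) ^ 3 := le_self_pow₀ (by linarith) (by norm_num)
    have h3 : D ≤ D ^ 3 := le_self_pow₀ hD1 (by norm_num)
    have h4 : (X ^ m) ^ 3 ≤ D := le_mul_of_one_le_left (by positivity) (by linarith)
    linarith
  have hN1 : nTS CTS P ≤ CTS * D ^ 3 := by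
    calc nTS CTS P ≤ CTS * (epsTS P)⁻¹ ^ 2 * D :=
          mul_le_mul_of_nonneg_left h.log_inv_deltaTS_le (by positivity)
      _ ≤ CTS * D ^ 2 * D := by gcongr
      _ = _ := by ring
  have hN2 : nPad Cpad P ≤ Cpad * D ^ 3 := by
    calc nPad Cpad P ≤ Cpad * (gPad P)⁻¹ ^ 2 * D :=
          mul_le_mul_of_nonneg_left hlogG (by positivity)
      _ ≤ Cpad * D ^ 2 * D := by gcongr
      _ = _ := by ring
  have hN3 : (nBoot P : ℝ) ≤ 2 * M * D ^ 3 := by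
    calc (nBoot P : ℝ) ≤ ⌈M * X⌉₊ := by exact_mod_cast h.nBoot_le
      _ ≤ 2 * M * X := h.ceil_le
      _ ≤ _ := by gcongr
  have hmax : max (nTS CTS P) (max (nBoot P : ℝ) (nPad Cpad P)) ≤
      (CTS + Cpad + 2) * M * D ^ 3 := by
    have hD3 : 0 ≤ D ^ 3 := by positivity
    refine max_le (hN1.trans ?_) (max_le (hN3.trans ?_) (hN2.trans ?_)) <;>
      refine mul_le_mul_of_nonneg_right ?_ hD3 <;> nlinarith
  have hmax0 : 0 ≤ max (nTS CTS P) (max (nBoot P : ℝ) (nPad Cpad P)) :=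
    le_max_of_le_right (le_max_of_le_left (Nat.cast_nonneg _))
  have hlog : Real.log ((gPad P)⁻¹ * (pBoot P)⁻¹) ≤ 3 * M * D := by
    rw [Real.log_mul hG0.ne' hp0.ne']
    have := h.log_inv_pBoot_le
    nlinarith
  calc rndsUB CUB Cpad P (nTS CTS P)
      ≤ CUB * K * max (nTS CTS P) (max (nBoot P : ℝ) (nPad Cpad P)) * (gPad P)⁻¹ * (3 * M * D) :=
        mul_le_mul_of_nonneg_left hlog (by positivity)
    _ ≤ CUB * K * ((CTS + Cpad + 2) * M * D ^ 3) * D * (3 * M * D) := by gcongr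
    _ = _ := by ring

end BetaBandit

lemma betaBandit_of_priorMean_antitone {K : ℕ} (hK : 2 ≤ K) {a b : Fin K → ℝ} {ℓ : Fin K}
    {M m : ℝ} (hab : ∀ i, 0 < a i ∧ 0 < b i) (hone : ∀ i, i ≠ ℓ → 1 ≤ a i ∧ 1 ≤ b i)
    (hM : a ℓ + b ℓ = M) (hst : ∀ i, i ≠ ℓ → a i + b i ≤ m) (hm : 2 ≤ m) (hmM : m ≤ M)
    {P : Fin K → Measure ℝ} (hP : ∀ i, P i = betaMeasure (a i) (b i))
    (hord : ∀ i j, i ≤ j → priorMean (P j) ≤ priorMean (P i)) :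
    BetaBandit P a b ℓ M m
      (max m (max (1 - priorMean (P ℓ))⁻¹ ((priorMean (P ℓ))⁻¹ ^ (ℓ : ℕ)))) := by
  set X := max m (max (1 - priorMean (P ℓ))⁻¹ ((priorMean (P ℓ))⁻¹ ^ (ℓ : ℕ))) with hX
  have hmX : m ≤ X := le_max_left _ _
  have hX0 : 0 < X := by linarith
  have hX1 : (1 - priorMean (P ℓ))⁻¹ ≤ X := (le_max_left _ _).trans (le_max_right _ _)
  have hX2 : (priorMean (P ℓ))⁻¹ ^ (ℓ : ℕ) ≤ X := (le_max_right _ _).trans (le_max_right _ _)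
  have hmean : ∀ i, priorMean (P i) = a i / (a i + b i) := fun i ↦ by
    rw [hP i, priorMean, integral_id_betaMeasure (hab i).1 (hab i).2]
  have hmean' : ∀ i, 1 - priorMean (P i) = b i / (a i + b i) := fun i ↦ by
    have := add_pos (hab i).1 (hab i).2
    rw [hmean i]; field_simp; ring
  have hpos : ∀ i, 0 < priorMean (P i) := fun i ↦ by
    rw [hmean i]; exact div_pos (hab i).1 (add_pos (hab i).1 (hab i).2)
  have hpos' : ∀ i, 0 < 1 - priorMean (P i) := fun i ↦ by
    rw [hmean' i]; exact div_pos (hab i).2 (add_pos (hab i).1 (hab i).2)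
  have hinv : X⁻¹ ≤ m⁻¹ := inv_anti₀ (by linarith) hmX
  have hlow : ∀ i, i ≠ ℓ → X⁻¹ ≤ priorMean (P i) := fun i hi ↦ by
    refine hinv.trans ?_
    rw [hmean i, ← one_div]
    exact div_le_div₀ (hab i).1.le (hone i hi).1 (add_pos (hab i).1 (hab i).2) (hst i hi)
  have hpow : X⁻¹ ≤ priorMean (P ℓ) ^ (ℓ : ℕ) := by
    refine inv_le_of_inv_le₀ (pow_pos (hpos ℓ) _) ?_
    rwa [← inv_pow]
  refine ⟨hK, hm, hmM, hmX, hP, hab, hone, hst, hM, fun i ↦ ?_, fun i ↦ ?_, hpow⟩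
  · by_cases hi : i = ℓ
    · subst hi
      by_cases h0 : (i : ℕ) = 0
      · have h1 : (⟨1, by lia⟩ : Fin K) ≠ i := fun h ↦ by
          rw [← h] at h0; simp at h0
        exact (hlow _ h1).trans (hord _ _ (by simp [Fin.le_def, h0]))
      · exact hpow.trans (pow_le_of_le_one (hpos i).le (by linarith [hpos' i]) h0)
    · exact hlow i hi
  · have : X⁻¹ ≤ 1 - priorMean (P i) := by
      by_cases hi : i = ℓ
      · subst hi
        exact inv_le_of_inv_le₀ (hpos' i) hX1
      · refine hinv.trans ?_
        rw [hmean' i, ← one_div]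
        exact div_le_div₀ (hab i).2.le (hone i hi).2 (add_pos (hab i).1 (hab i).2) (hst i hi)
    linarith

end IncentivizedExploration

/-! ### Absorbing constants into the exponents, and the final theorem. -/

lemma mul_pow_le_sq_mul_rpow {C K X M m : ℝ} {n : ℕ} (hC : C ≤ 2 ^ n) (hK : 2 ≤ K) (hX : 2 ≤ X)
    (hm : 2 ≤ m) :
    C * M ^ 2 * K * (K * (X ^ m) ^ 3) ^ 5 ≤
      M ^ 2 * K ^ (15 + n : ℝ) * X ^ ((15 + n : ℝ) * m) := by
  have hY : 1 ≤ X ^ m := Real.one_le_rpow (by linarith) (by linarith)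
  have h1 : X ^ ((15 + n : ℝ) * m) = (X ^ m) ^ (15 + n) := by
    rw [mul_comm, Real.rpow_mul (by linarith), ← Real.rpow_natCast]
    push_cast
    rfl
  have h2 : K ^ (15 + n : ℝ) = K ^ (15 + n) := by
    rw [← Real.rpow_natCast]
    push_cast
    rfl
  rw [h1, h2]
  calc C * M ^ 2 * K * (K * (X ^ m) ^ 3) ^ 5 = M ^ 2 * (C * K ^ 6) * (X ^ m) ^ 15 := by ring
    _ ≤ M ^ 2 * (K ^ n * K ^ 15) * (X ^ m) ^ (15 + n) := by
        have h3 : C ≤ K ^ n := hC.trans (pow_le_pow_left₀ (by norm_num) hK n)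
        have h4 : K ^ 6 ≤ K ^ 15 := pow_le_pow_right₀ (by linarith) (by norm_num)
        have h5 : (X ^ m) ^ 15 ≤ (X ^ m) ^ (15 + n) := pow_le_pow_right₀ hY (by lia)
        have hK0 : 0 ≤ K := by linarith
        gcongr
    _ = _ := by ring

/-- Both `u⁻¹` and `(1 - u)⁻¹` are at most `4 ≤ m ^ 2`. -/
lemma max_le_pow_of_mem_Icc {u m : ℝ} (hu : u ∈ Set.Icc (1 / 4 : ℝ) (3 / 4)) (hm : 2 ≤ m)
    (l : ℕ) : max m (max (1 - u)⁻¹ (u⁻¹ ^ l)) ≤ m ^ (2 * (l + 1)) := by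
  obtain ⟨h1, h2⟩ := hu
  have hm4 : 4 ≤ m ^ 2 := by nlinarith
  have h4 : (m ^ 2) ^ 1 ≤ m ^ (2 * (l + 1)) := by
    rw [pow_mul]
    exact pow_le_pow_right₀ (by linarith) (by lia)
  refine max_le (by nlinarith) (max_le ?_ ?_)
  · have : (1 - u)⁻¹ ≤ 4 := inv_le_of_inv_le₀ (by norm_num) (by linarith)
    linarith
  · have : u⁻¹ ≤ 4 := inv_le_of_inv_le₀ (by norm_num) (by linarith)
    calc u⁻¹ ^ l ≤ (m ^ 2) ^ l :=
          pow_le_pow_left₀ (inv_nonneg.2 (by linarith)) (this.trans hm4) l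
      _ ≤ (m ^ 2) ^ (l + 1) := pow_le_pow_right₀ (by linarith) (by lia)
      _ = _ := by rw [pow_mul]

/-- Arms are indexed from `0`: the value of `ℓ` is the usual one-based index minus one. -/
theorem corollary5p8 (CTS Cpad CUB : ℝ) (hCTS : 0 < CTS) (hCpad : 0 < Cpad) (hCUB : 0 < CUB) :
    ∃ c : ℝ, 0 < c ∧
      ∀ (K : ℕ) (_ : 2 ≤ K) (a b : Fin K → ℝ) (ℓ : Fin K) (M m : ℝ),
        (∀ i, 0 < a i ∧ 0 < b i) →
        (∀ i, i ≠ ℓ → 1 ≤ a i ∧ 1 ≤ b i) →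
        a ℓ + b ℓ = M →
        (∀ i, i ≠ ℓ → a i + b i ≤ m) →
        2 ≤ m → m ≤ M →
        ∀ P : Fin K → Measure ℝ, (∀ i, P i = betaMeasure (a i) (b i)) →
        (∀ i j, i ≤ j →
          IncentivizedExploration.priorMean (P j) ≤ IncentivizedExploration.priorMean (P i)) →
        IncentivizedExploration.WellDefined P ∧
        IncentivizedExploration.rndsUB CUB Cpad P (IncentivizedExploration.nTS CTS P) ≤
          M ^ 2 * (K : ℝ) ^ c *
            (max m (max (1 - IncentivizedExploration.priorMean (P ℓ))⁻¹
              ((IncentivizedExploration.priorMean (P ℓ))⁻¹ ^ (ℓ : ℕ)))) ^ (c * m) ∧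
        (IncentivizedExploration.priorMean (P ℓ) ∈ Set.Icc (1 / 4 : ℝ) (3 / 4) →
          IncentivizedExploration.rndsUB CUB Cpad P (IncentivizedExploration.nTS CTS P) ≤
            M ^ 2 * (K : ℝ) ^ c * m ^ (c * ((ℓ : ℕ) + 1 : ℝ) * m)) := by
  obtain ⟨n, hn⟩ := pow_unbounded_of_one_lt (3 * CUB * (CTS + Cpad + 2)) (one_lt_two (α := ℝ))
  -- The 15 is the power of `Y` in `(K Y³)⁵`, and `n` absorbs the constants through `K ≥ 2`. The
  -- doubling pays for `X ≤ m ^ (2 (ℓ + 1))` in the last claim.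
  refine ⟨2 * (15 + n), by positivity, ?_⟩
  intro K hK a b ℓ M m hab hone hM hst hm hmM P hP hord
  have h := IncentivizedExploration.betaBandit_of_priorMean_antitone hK hab hone hM hst hm hmM
    hP hord
  set u := IncentivizedExploration.priorMean (P ℓ) with hu
  set X := max m (max (1 - u)⁻¹ (u⁻¹ ^ (ℓ : ℕ))) with hX
  have hX2 : 2 ≤ X := h.two_le_X
  have hKR : (2 : ℝ) ≤ K := h.K_ge
  have hbound := (h.rndsUB_le hCTS hCpad hCUB).trans (mul_pow_le_sq_mul_rpow hn.le hKR hX2 hm)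
  have hexp : (15 + n : ℝ) ≤ 2 * (15 + n) := by linarith [n.cast_nonneg (α := ℝ)]
  have hKc : (K : ℝ) ^ (15 + n : ℝ) ≤ (K : ℝ) ^ (2 * (15 + n) : ℝ) :=
    Real.rpow_le_rpow_of_exponent_le (by linarith) hexp
  refine ⟨h.wellDefined, hbound.trans ?_, fun hmem ↦ hbound.trans ?_⟩
  · have : X ^ ((15 + n : ℝ) * m) ≤ X ^ (2 * (15 + n) * m : ℝ) :=
      Real.rpow_le_rpow_of_exponent_le (by linarith)
        (mul_le_mul_of_nonneg_right hexp (by linarith))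
    gcongr
  · have : X ^ ((15 + n : ℝ) * m) ≤ m ^ (2 * (15 + n) * ((ℓ : ℕ) + 1) * m : ℝ) := by
      calc X ^ ((15 + n : ℝ) * m) ≤ (m ^ (2 * ((ℓ : ℕ) + 1))) ^ ((15 + n : ℝ) * m) :=
            Real.rpow_le_rpow (by linarith) (max_le_pow_of_mem_Icc hmem hm ℓ) (by positivity)
        _ = _ := by
            rw [← Real.rpow_natCast, ← Real.rpow_mul (by linarith)]
            push_cast
            ring_nf
    gcongr
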